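/- Let $G$ be a group and let $H$ be a torsion-free (Gromov) hyperbolic group, regarded as a discrete group with a proper left-invariant metric $d$; bounded subsets of $H$ are understood with respect to $d$ (so they are exactly the finite subsets). For a map $\phi:G\to H$ and $g\in G$ let $\mathfrak d_g\phi:G\to H$ be the map $(\mathfrak d_g\phi)(x)=\phi(gx)\phi(x)^{-1}$, and put $\mathfrak d_{g_1,g_2,g_3}=\mathfrak d_{g_1}\circ\mathfrak d_{g_2}\circ\mathfrak d_{g_3}$. A map $\phi$ is polynomial of degree $-1$ if $\phi(x)=1$ for all $x\in G$, and, for $d\ge -1$, it is polynomial of degree $d+1$ if $\mathfrak d_g\phi$ is polynomial of degree $d$ for every $g\in G$; it is called quadratic if it is polynomial of degree $2$. Put $$P_2(\phi)=\{(\mathfrak d_{g_1,g_2,g_3}\phi)(1)\mid g_1,g_2,g_3\in G\}.$$ The map $\phi$ is called quasi-quadratic if $P_2(\phi)$ is bounded. A quasi-quadratic map $\phi:G\to H$ with $\phi(1)=1$ is called nearly normal if there are finite subsets $K,Y\subseteq H$ such that, with $\Xi=\langle K\rangle$: (Q1) $P_2(\phi)\subseteq K$; (Q2) $\phi(G)\subseteq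 N_H(\Xi)$; (Q3) $Y=Y^{-1}$ and $\phi(G)\cup\phi(G)^{-1}\subseteq\bigcup_{y\in Y}C_H(\Xi)\,y$. Let $\phi:G\to H$ be a nearly normal quasi-quadratic map which is not bounded, i.e. $\phi(G)$ is an unbounded subset of $H$. Then either $\phi$ is quadratic, or $\phi(G)$ is contained in a cyclic subgroup of $H$. -/

import Mathlib

open scoped Pointwise

namespace QuasiQuadratic

/-- The word length of `h` with respect to `S`: the least length of a word in the letters
`S ∪ S⁻¹` representing `h` (it is used only for generating sets `S`, so a word exists). -/
noncomputable def wordLength {H : Type*} [Group H] (S : Set H) (h : H) : ℕ :=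
  sInf {n : ℕ | ∃ l : List H, (∀ x ∈ l, x ∈ S ∪ S⁻¹) ∧ l.prod = h ∧ l.length = n}

/-- The left-invariant word metric of `H` with respect to `S`. -/
noncomputable def wordDist {H : Type*} [Group H] (S : Set H) (x y : H) : ℝ :=
  (wordLength S (x⁻¹ * y) : ℝ)

/-- The Gromov product `(x | y)_w` for the word metric. -/
noncomputable def gromovProduct {H : Type*} [Group H] (S : Set H) (x y w : H) : ℝ :=
  (wordDist S x w + wordDist S y w - wordDist S x y) / 2

/-- A group is hyperbolic if it has a finite generating set whose word metric is
Gromov hyperbolic (four-point condition). -/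
def IsHyperbolicGroup (H : Type*) [Group H] : Prop :=
  ∃ S : Set H, S.Finite ∧ Subgroup.closure S = ⊤ ∧
    ∃ δ : ℝ, ∀ x y z w : H,
      min (gromovProduct S x y w) (gromovProduct S y z w) - δ ≤ gromovProduct S x z w

/-- The group has no nontrivial element of finite order. -/
def IsTorsionFreeGroup (H : Type*) [Group H] : Prop :=
  ∀ h : H, IsOfFinOrder h → h = 1

/-- The difference map `(∂_g φ)(x) = φ(gx) φ(x)⁻¹`. -/
def diff {G H : Type*} [Group G] [Group H] (g : G) (φ : G → H) : G → H :=
  fun x => φ (g * x) * (φ x)⁻¹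

/-- `IsPolynomialBelow n φ`: the map `φ` is polynomial of degree `n - 1` (as an integer).
Degree `-1` means identically `1`, and `φ` has degree `d + 1` if all `∂_g φ` have degree `d`. -/
def IsPolynomialBelow {G H : Type*} [Group G] [Group H] : ℕ → (G → H) → Prop
  | 0, φ => ∀ x, φ x = 1
  | n + 1, φ => ∀ g : G, IsPolynomialBelow n (diff g φ)

/-- Polynomial maps of degree `d ≥ 0`. -/
def IsPolynomial {G H : Type*} [Group G] [Group H] (d : ℕ) (φ : G → H) : Prop :=
  IsPolynomialBelow (d + 1) φ

/-- Quadratic maps are the polynomial maps of degree `2`. -/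
def IsQuadratic {G H : Type*} [Group G] [Group H] (φ : G → H) : Prop :=
  IsPolynomial 2 φ

/-- The iterated difference `∂_{g₁,…,gᵣ} φ = ∂_{g₁} (∂_{g₂} (⋯ (∂_{gᵣ} φ)))`. -/
def iterDiff {G H : Type*} [Group G] [Group H] (l : List G) (φ : G → H) : G → H :=
  l.foldr diff φ

/-- The defect set `P_d(φ)` of all values `(∂_{g₁,…,g_{d+1}} φ)(1)`. -/
def defectSet {G H : Type*} [Group G] [Group H] (d : ℕ) (φ : G → H) : Set H :=
  {h | ∃ l : List G, l.length = d + 1 ∧ h = iterDiff l φ 1}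

/-- Quasi-polynomial maps of degree `d`: the set `P_d(φ)` is bounded in the metric of `H`. -/
def IsQuasiPolynomial {G H : Type*} [Group G] [Group H] [MetricSpace H]
    (d : ℕ) (φ : G → H) : Prop :=
  Bornology.IsBounded (defectSet d φ)

/-- Quasi-quadratic maps are the quasi-polynomial maps of degree `2`. -/
def IsQuasiQuadratic {G H : Type*} [Group G] [Group H] [MetricSpace H] (φ : G → H) : Prop :=
  IsQuasiPolynomial 2 φ

/-- Nearly normal (unital) quasi-quadratic maps. Here `Ξ = ⟨K⟩` is `Subgroup.closure K`. -/
structure IsNearlyNormal {G H : Type*} [Group G] [Group H] [MetricSpace H]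
    (φ : G → H) : Prop where
  unital : φ 1 = 1
  quasiQuadratic : IsQuasiQuadratic φ
  exists_sets : ∃ K Y : Set H, K.Finite ∧ Y.Finite ∧
    defectSet 2 φ ⊆ K ∧
    Set.range φ ⊆ (Subgroup.normalizer (Subgroup.closure K : Set H) : Set H) ∧
    Y⁻¹ = Y ∧
    Set.range φ ∪ (Set.range φ)⁻¹ ⊆
      (Subgroup.centralizer (Subgroup.closure K : Set H) : Set H) * Y

end QuasiQuadratic

namespace QuasiQuadratic

/-! ### Word metrics and geodesics in a hyperbolic group. -/

section WordMetric

variable {H : Type*} [Group H] {S : Set H}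

/-! In a torsion-free hyperbolic group the centralizer of any `h ≠ 1` is cyclic
(`isCyclic_centralizer`) and contains the normalizer of `⟨h⟩` (`normalizer_zpowers_le`). If `Ξ = 1`,
the defect set is trivial and `φ` is quadratic. Otherwise unboundedness forces some `c ≠ 1` to
centralize `Ξ`, since else `φ(G) ⊆ Y`. So `Ξ` lies in the cyclic group `C(c)`, `Ξ = ⟨ξ⟩`, and `φ(G)
⊆ N(Ξ) ⊆ C(ξ)`, which is cyclic.

The geometric input is that `⟨h⟩` has finite index in `C(h)`: shortest coset representatives have
bounded length (`exists_wordLength_bound`). -/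

theorem wordLength_le_of_prod {h : H} (l : List H) (hl : ∀ x ∈ l, x ∈ S ∪ S⁻¹)
    (hp : l.prod = h) : wordLength S h ≤ l.length :=
  Nat.sInf_le ⟨l, hl, hp, rfl⟩

theorem exists_word (hS : Subgroup.closure S = ⊤) (h : H) :
    ∃ l : List H, (∀ x ∈ l, x ∈ S ∪ S⁻¹) ∧ l.prod = h ∧ l.length = wordLength S h := by
  have hne : {n : ℕ | ∃ l : List H,
      (∀ x ∈ l, x ∈ S ∪ S⁻¹) ∧ l.prod = h ∧ l.length = n}.Nonempty := by
    have hh : h ∈ (Subgroup.closure S).toSubmonoid := hS ▸ Subgroup.mem_top h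
    rw [Subgroup.closure_toSubmonoid] at hh
    obtain ⟨l, hl, hp⟩ := Submonoid.exists_list_of_mem_closure hh
    exact ⟨_, l, hl, hp, rfl⟩
  exact Nat.sInf_mem hne

theorem wordLength_mul_le (hS : Subgroup.closure S = ⊤) (x y : H) :
    wordLength S (x * y) ≤ wordLength S x + wordLength S y := by
  obtain ⟨l, hl, hp, hn⟩ := exists_word hS x
  obtain ⟨k, hk, hq, hm⟩ := exists_word hS y
  have := wordLength_le_of_prod (S := S) (l ++ k)
    (fun z hz => (List.mem_append.1 hz).elim (hl z) (hk z)) List.prod_append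
  rw [hp, hq, List.length_append] at this
  omega

theorem wordLength_inv_le (hS : Subgroup.closure S = ⊤) (x : H) :
    wordLength S x⁻¹ ≤ wordLength S x := by
  obtain ⟨l, hl, hp, hn⟩ := exists_word hS x
  have := wordLength_le_of_prod (S := S) (h := x⁻¹) (l.map (·⁻¹)).reverse
    (fun z hz => by
      simp only [List.mem_reverse, List.mem_map] at hz
      obtain ⟨w, hw, rfl⟩ := hz
      rcases hl w hw with h | h
      · exact Or.inr (by simpa using h)
      · exact Or.inl h) (by rw [← List.prod_inv_reverse, hp])
  simpa [hn] using this

theorem wordLength_inv (hS : Subgroup.closure S = ⊤) (x : H) :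
    wordLength S x⁻¹ = wordLength S x :=
  le_antisymm (wordLength_inv_le hS x) (by simpa using wordLength_inv_le hS x⁻¹)

theorem finite_wordLength_le (hS : Subgroup.closure S = ⊤) (hfin : S.Finite) (n : ℕ) :
    {h : H | wordLength S h ≤ n}.Finite := by
  have hT : Finite ↥(S ∪ S⁻¹) := (hfin.union hfin.inv).to_subtype
  refine ((List.finite_length_le ↥(S ∪ S⁻¹) n).image
    (fun l => (l.map Subtype.val).prod)).subset ?_
  intro h hh
  obtain ⟨l, hl, hp, hn⟩ := exists_word hS h
  lift l to List ↥(S ∪ S⁻¹) using hl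
  refine ⟨l, ?_, hp⟩
  have : l.length = wordLength S h := by simpa using hn
  exact this.trans_le hh

/-- Every group element splits into factors of prescribed lengths. -/
theorem exists_mul_eq_of_le (hS : Subgroup.closure S = ⊤) (x : H) {a b : ℕ}
    (hab : a + b = wordLength S x) :
    ∃ m k : H, m * k = x ∧ wordLength S m = a ∧ wordLength S k = b := by
  obtain ⟨l, hl, hp, hn⟩ := exists_word hS x
  have h1 := wordLength_le_of_prod (S := S) (l.take a)
    (fun z hz => hl z (List.mem_of_mem_take hz)) rfl
  have h2 := wordLength_le_of_prod (S := S) (l.drop a)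
    (fun z hz => hl z (List.mem_of_mem_drop hz)) rfl
  have h3 : (l.take a).prod * (l.drop a).prod = x := by rw [List.prod_take_mul_prod_drop, hp]
  have h4 := wordLength_mul_le hS (l.take a).prod (l.drop a).prod
  rw [h3] at h4
  rw [List.length_take] at h1
  rw [List.length_drop] at h2
  exact ⟨_, _, h3, by omega, by omega⟩

theorem wordDist_mul_left (g x y : H) : wordDist S (g * x) (g * y) = wordDist S x y := by
  simp [wordDist, mul_assoc]

theorem wordDist_comm (hS : Subgroup.closure S = ⊤) (x y : H) :
    wordDist S x y = wordDist S y x := by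
  unfold wordDist
  rw [← wordLength_inv hS]
  simp

theorem four_point {δ : ℝ}
    (hδ : ∀ x y z w : H,
      min (gromovProduct S x y w) (gromovProduct S y z w) - δ ≤ gromovProduct S x z w)
    (x y z w : H) :
    wordDist S x z + wordDist S y w ≤
      max (wordDist S x y + wordDist S z w) (wordDist S y z + wordDist S x w) + 2 * δ := by
  have h := hδ x y z w
  unfold gromovProduct at h
  rcases min_cases ((wordDist S x w + wordDist S y w - wordDist S x y) / 2)
    ((wordDist S y w + wordDist S z w - wordDist S y z) / 2) with ⟨h1, -⟩ | ⟨h1, -⟩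
  · have := le_max_left (wordDist S x y + wordDist S z w) (wordDist S y z + wordDist S x w)
    linarith
  · have := le_max_right (wordDist S x y + wordDist S z w) (wordDist S y z + wordDist S x w)
    linarith

/-- If `x` commutes with `y` and is no longer than `y * x` and `y⁻¹ * x`, then `y` moves the points
in the middle of a geodesic from `1` to `x` by a bounded amount. -/
theorem wordLength_conj_le (hS : Subgroup.closure S = ⊤) {δ : ℝ}
    (hδ : ∀ x y z w : H,
      min (gromovProduct S x y w) (gromovProduct S y z w) - δ ≤ gromovProduct S x z w)
    {y m k : H} (hc : Commute y (m * k))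
    (hmk : wordLength S (m * k) = wordLength S m + wordLength S k)
    (hm : wordLength S y ≤ wordLength S m) (hk : wordLength S y ≤ wordLength S k)
    (h1 : wordLength S (m * k) ≤ wordLength S (y * (m * k)))
    (h2 : wordLength S (m * k) ≤ wordLength S (y⁻¹ * (m * k))) :
    (wordLength S (m⁻¹ * y * m) : ℝ) ≤ 6 * δ := by
  have dcomm := wordDist_comm (S := S) hS
  set x := m * k with hx
  have e1 : wordDist S 1 x = wordLength S x := by simp [wordDist]
  have e2 : wordDist S 1 m = wordLength S m := by simp [wordDist]
  have e3 : wordDist S m x = wordLength S k := by simp [wordDist, hx]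
  have e4 : wordDist S 1 y = wordLength S y := by simp [wordDist]
  have e5 : wordDist S y (y * x) = wordLength S x := by simp [wordDist]
  have e6 : wordDist S y (y * m) = wordLength S m := by simp [wordDist]
  have e7 : wordDist S (y * m) (y * x) = wordLength S k := by simp [wordDist, hx, mul_assoc]
  have e8 : wordDist S x (y * x) = wordLength S y := by
    simp [wordDist, hc.eq]
  have e9 : wordDist S 1 (y * x) = wordLength S (y * x) := by simp [wordDist]
  have e10 : wordDist S y x = wordLength S (y⁻¹ * x) := by simp [wordDist]
  have e11 : wordDist S m (y * m) = wordLength S (m⁻¹ * y * m) := by simp [wordDist, mul_assoc]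
  -- In the quadrilateral `1, x, y * x, y`, `q1` and minimality of `x` bound both diagonals by `|x|
  -- + 2δ`. Then `q2` and `q3` give `d(1, ym) ≤ |m| + 4δ` and `d(x, ym) ≤ |k| + 4δ`, and `q4` adds
  -- the last `2δ`.
  have q1 := four_point hδ 1 x (y * x) y
  have q2 := four_point hδ (y * m) y 1 (y * x)
  have q3 := four_point hδ (y * m) y x (y * x)
  have q4 := four_point hδ m 1 (y * m) x
  rw [dcomm x y, dcomm (y * x) y] at q1
  rw [dcomm (y * m) y, dcomm y 1] at q2
  rw [dcomm (y * m) y] at q3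
  rw [dcomm m 1, dcomm (y * m) x, dcomm 1 (y * m)] at q4
  rw [dcomm (y * m) 1] at q2
  rw [dcomm (y * m) x] at q3
  rw [dcomm 1 (y * m)] at q2
  simp only [e1, e2, e3, e4, e5, e6, e7, e8, e9, e10, e11] at q1 q2 q3 q4
  have hmk' : (wordLength S x : ℝ) = wordLength S m + wordLength S k := by exact_mod_cast hmk
  have hm' : (wordLength S y : ℝ) ≤ wordLength S m := by exact_mod_cast hm
  have hk' : (wordLength S y : ℝ) ≤ wordLength S k := by exact_mod_cast hk
  have h1' : (wordLength S x : ℝ) ≤ wordLength S (y * x) := by exact_mod_cast h1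
  have h2' : (wordLength S x : ℝ) ≤ wordLength S (y⁻¹ * x) := by exact_mod_cast h2
  rw [← sub_le_iff_le_add, le_max_iff] at q1 q2 q3 q4
  rcases q1 with q1 | q1 <;> rcases q2 with q2 | q2 <;> rcases q3 with q3 | q3 <;>
    rcases q4 with q4 | q4 <;> linarith

/-- Elements of the centralizer of an element of infinite order that are shortest in their coset
have bounded length. -/
theorem exists_wordLength_bound (hS : Subgroup.closure S = ⊤) (hfin : S.Finite) {δ : ℝ}
    (hδ : ∀ x y z w : H,
      min (gromovProduct S x y w) (gromovProduct S y z w) - δ ≤ gromovProduct S x z w)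
    {h : H} (hh : ¬ IsOfFinOrder h) :
    ∃ B : ℕ, ∀ x : H, Commute h x → (∀ n : ℤ, wordLength S x ≤ wordLength S (h ^ n * x)) →
      wordLength S x ≤ B := by
  have hball := finite_wordLength_le hS hfin ⌊6 * δ⌋₊
  set N := hball.toFinset.card
  -- `L` dominates the length of each of the `N + 1` powers of `h`. If `|x| > 2L`, cutting a
  -- geodesic to `x` at distance `L` puts all their conjugates by `m` in a ball with `N` elements,
  -- so two powers coincide.
  set L := ∑ n ∈ Finset.range (N + 1), wordLength S (h ^ n) with hL
  refine ⟨2 * L, fun x hx hmin => ?_⟩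
  by_contra! hlt
  obtain ⟨m, k, rfl, hm, hk⟩ := exists_mul_eq_of_le hS x
    (show L + (wordLength S x - L) = wordLength S x by omega)
  have key : ∀ n ∈ Finset.range (N + 1), m⁻¹ * h ^ n * m ∈ hball.toFinset := by
    intro n hn
    have hle : wordLength S (h ^ n) ≤ L :=
      Finset.single_le_sum (f := fun n => wordLength S (h ^ n)) (fun _ _ => Nat.zero_le _) hn
    rw [Set.Finite.mem_toFinset]
    refine Nat.le_floor (wordLength_conj_le hS hδ (hx.pow_left n) (by omega) (by omega) (by omega)
      ?_ ?_)
    · simpa using hmin n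
    · simpa using hmin (-n)
  obtain ⟨i, -, j, -, hij, he⟩ := Finset.exists_ne_map_eq_of_card_lt_of_maps_to
    (by simp [N]) key
  refine hij (injective_pow_iff_not_isOfFinOrder.2 hh ?_)
  simpa using he

end WordMetric

/-! ### Centralizers and normalizers of cyclic subgroups. -/

section Centralizers

variable {H : Type*} [Group H]

theorem IsHyperbolicGroup.exists_finite_centralizer (hyp : IsHyperbolicGroup H) {h : H}
    (hh : ¬ IsOfFinOrder h) :
    ∃ F : Set H, F.Finite ∧ ∀ x : H, Commute h x → ∃ n : ℤ, h ^ n * x ∈ F := by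
  obtain ⟨S, hfin, hS, δ, hδ⟩ := hyp
  obtain ⟨B, hB⟩ := exists_wordLength_bound hS hfin hδ hh
  refine ⟨_, finite_wordLength_le hS hfin B, fun x hx => ?_⟩
  let f : ℤ → ℕ := fun n => wordLength S (h ^ n * x)
  refine ⟨Function.argmin f, hB _ ?_ fun k => ?_⟩
  · exact ((Commute.refl h).zpow_right _).mul_right hx
  · rw [← mul_assoc, ← zpow_add]
    exact Function.argmin_le f _

theorem IsHyperbolicGroup.finiteIndex_zpowers (hyp : IsHyperbolicGroup H) {h : H}
    (hh : ¬ IsOfFinOrder h) :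
    ((Subgroup.zpowers h).subgroupOf (Subgroup.centralizer {h})).FiniteIndex := by
  obtain ⟨F, hF, hFx⟩ := hyp.exists_finite_centralizer hh
  set A := Subgroup.centralizer {h}
  have : Finite (F ∩ A : Set H) := (hF.inter_of_left _).to_subtype
  have hsurj : Function.Surjective
      (fun y : (F ∩ A : Set H) =>
        ((⟨y.1, y.2.2⟩ : A) : A ⧸ (Subgroup.zpowers h).subgroupOf A)) := by
    intro q
    induction q using QuotientGroup.induction_on with
    | H x =>
      have hx : Commute h x := (Subgroup.mem_centralizer_singleton_iff.1 x.2).symm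
      obtain ⟨n, hn⟩ := hFx x hx
      have hnA : h ^ n * (x : H) ∈ A := A.mul_mem
        (A.zpow_mem (Subgroup.mem_centralizer_singleton_iff.2 rfl) n) x.2
      refine ⟨⟨_, hn, hnA⟩, QuotientGroup.eq.2 ?_⟩
      rw [Subgroup.mem_subgroupOf]
      refine Subgroup.mem_zpowers_iff.2 ⟨-n, ?_⟩
      simp only [Subgroup.coe_mul, Subgroup.coe_inv, (hx.zpow_left n).eq]
      group
  have := Finite.of_surjective _ hsurj
  exact Subgroup.finiteIndex_of_finite_quotient

/-- The transfer into a central subgroup of finite index is a power map, hence a power map is a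
homomorphism from `C(h)` to `⟨h⟩`; without torsion it is injective. -/
theorem isCyclic_centralizer (hyp : IsHyperbolicGroup H) (tf : IsTorsionFreeGroup H) {h : H}
    (hh : h ≠ 1) : IsCyclic (Subgroup.centralizer {h}) := by
  have hfi := hyp.finiteIndex_zpowers (fun hf => hh (tf h hf))
  set A := Subgroup.centralizer {h}
  set Z := (Subgroup.zpowers h).subgroupOf A
  have hZ : Z ≤ Subgroup.center A := by
    intro z hz
    obtain ⟨n, hn⟩ := Subgroup.mem_zpowers_iff.1 (Subgroup.mem_subgroupOf.1 hz)
    refine Subgroup.mem_center_iff.2 fun x => Subtype.ext ?_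
    have hx : Commute (x : H) h := Subgroup.mem_centralizer_singleton_iff.1 x.2
    have := hx.zpow_right n
    rw [hn] at this
    exact this
  have : (Subgroup.center A).FiniteIndex := Subgroup.finiteIndex_of_le hZ
  have tfA : ∀ (x : A) (n : ℕ), n ≠ 0 → x ^ n = 1 → x = 1 := fun x n hn hx =>
    Subtype.ext (tf x (isOfFinOrder_iff_pow_eq_one.2
      ⟨n, Nat.pos_of_ne_zero hn, by simpa using congrArg Subtype.val hx⟩))
  have hZn : Z.Normal := ⟨fun z hz g => by
    rwa [Subgroup.mem_center_iff.1 (hZ hz) g, mul_inv_cancel_right]⟩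
  let p : A →* A := MonoidHom.mk' (fun x => (x ^ (Subgroup.center A).index) ^ Z.index) fun x y => by
    have hmul : (x * y) ^ (Subgroup.center A).index =
        x ^ (Subgroup.center A).index * y ^ (Subgroup.center A).index :=
      congrArg Subtype.val (map_mul (MonoidHom.transferCenterPow A) x y)
    have hcomm : Commute (x ^ (Subgroup.center A).index) (y ^ (Subgroup.center A).index) :=
      Subgroup.mem_center_iff.1 ((Subgroup.center A).pow_index_mem y) _
    rw [hmul, hcomm.mul_pow]
  let q : A →* Z := p.codRestrict Z fun x => Z.pow_index_mem _
  have hq : Function.Injective q := by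
    refine (injective_iff_map_eq_one q).2 fun x hx => ?_
    have h1 : (x ^ (Subgroup.center A).index) ^ Z.index = 1 := congrArg Subtype.val hx
    rw [← pow_mul] at h1
    exact tfA x _ (mul_ne_zero Subgroup.FiniteIndex.index_ne_zero
      Subgroup.FiniteIndex.index_ne_zero) h1
  have : IsCyclic Z := isCyclic_of_injective
    (A.subtype.subgroupComap (Subgroup.zpowers h)) fun a b hab => by
      have hab' := congrArg Subtype.val hab
      exact Subtype.ext (Subtype.ext hab')
  exact isCyclic_of_injective q hq

/-- In a torsion-free hyperbolic group the normalizer of a nontrivial cyclic subgroup centralizes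
this subgroup. -/
theorem normalizer_zpowers_le (hyp : IsHyperbolicGroup H) (tf : IsTorsionFreeGroup H) {h : H}
    (hh : h ≠ 1) :
    Subgroup.normalizer (Subgroup.zpowers h : Set H) ≤ Subgroup.centralizer {h} := by
  intro x hx
  have hfin : ¬ IsOfFinOrder h := fun hf => hh (tf h hf)
  have hinj := injective_zpow_iff_not_isOfFinOrder.2 hfin
  have key : ∀ y ∈ Subgroup.normalizer (Subgroup.zpowers h : Set H),
      ∃ n : ℤ, h ^ n = y * h * y⁻¹ := fun y hy =>
    Subgroup.mem_zpowers_iff.1 ((Subgroup.mem_normalizer_iff.1 hy h).1 (Subgroup.mem_zpowers h))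
  obtain ⟨a, ha⟩ := key x hx
  obtain ⟨b, hb⟩ := key x⁻¹ (inv_mem hx)
  have hab : h ^ (a * b) = h ^ (1 : ℤ) := by
    rw [zpow_mul, ha, conj_zpow, hb]; group
  have hab' : a * b = 1 := hinj hab
  rw [Subgroup.mem_centralizer_singleton_iff]
  rcases Int.isUnit_iff.1 (IsUnit.of_mul_eq_one _ hab') with rfl | rfl
  · rw [zpow_one] at ha
    nth_rewrite 2 [ha]; group
  -- If `x` inverts `h`, then `x ^ 2` centralizes `h`, so some `x ^ (2 * n)` equals `h ^ k`.
  -- Conjugation by `x` both fixes and inverts it, so `k = 0` and `x` is torsion.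
  · exfalso
    have hx2 : x ^ 2 ∈ Subgroup.centralizer {h} := by
      rw [Subgroup.mem_centralizer_singleton_iff]
      have : h = x * (x * h * x⁻¹) * x⁻¹ := by
        rw [← ha, ← conj_zpow, ← ha]; simp
      nth_rewrite 2 [this]; simp [pow_two, mul_assoc]
    have hfi := hyp.finiteIndex_zpowers hfin
    obtain ⟨n, hn0, hn⟩ := Subgroup.exists_pow_mem_of_index_ne_zero
      hfi.index_ne_zero (⟨x ^ 2, hx2⟩ : Subgroup.centralizer {h})
    obtain ⟨k, hk⟩ := Subgroup.mem_zpowers_iff.1 (Subgroup.mem_subgroupOf.1 hn.2)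
    have hk' : h ^ k = (x ^ 2) ^ n := hk
    have h1 : h ^ (-k) = h ^ k := by
      have : h ^ (-k) = x * h ^ k * x⁻¹ := by
        rw [← conj_zpow, ← ha, ← zpow_mul]; simp
      rw [this, hk']; group
    have hk0 : k = 0 := by have := hinj h1; omega
    have hx1 : x = 1 := tf x (isOfFinOrder_iff_pow_eq_one.2
      ⟨2 * n, by omega, by rw [pow_mul, ← hk', hk0, zpow_zero]⟩)
    rw [hx1] at ha
    have : h ^ (-1 : ℤ) = h ^ (1 : ℤ) := by rw [ha]; group
    have := hinj this
    omega

end Centralizers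

/-- Values at `1` suffice: they say that every second difference is constant. -/
theorem isQuadratic_of_defectSet {G H : Type*} [Group G] [Group H] {φ : G → H}
    (h : ∀ x ∈ defectSet 2 φ, x = 1) : IsQuadratic φ := by
  intro g₁ g₂ g₃ x
  have key : ∀ g, diff g₂ (diff g₁ φ) g = diff g₂ (diff g₁ φ) 1 := by
    intro g
    have h1 : diff g (diff g₂ (diff g₁ φ)) 1 = 1 := h _ ⟨[g, g₂, g₁], rfl, rfl⟩
    rw [diff, mul_inv_eq_one, mul_one] at h1
    exact h1
  rw [diff, key, key x, mul_inv_cancel]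

end QuasiQuadratic

theorem mainTheorem7 {G : Type*} {H : Type*} [Group G] [Group H]
    [MetricSpace H] [DiscreteTopology H] [ProperSpace H] [IsIsometricSMul H H]
    (hyp : QuasiQuadratic.IsHyperbolicGroup H) (tf : QuasiQuadratic.IsTorsionFreeGroup H)
    (φ : G → H) (hφ : QuasiQuadratic.IsNearlyNormal φ)
    (unbdd : ¬ Bornology.IsBounded (Set.range φ)) :
    QuasiQuadratic.IsQuadratic φ ∨
      ∃ C : Subgroup H, IsCyclic C ∧ Set.range φ ⊆ (C : Set H) := by
  obtain ⟨K, Y, -, hY, hPK, hN, -, hC⟩ := hφ.exists_sets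
  by_cases hK : Subgroup.closure K = ⊥
  · refine Or.inl (QuasiQuadratic.isQuadratic_of_defectSet fun x hx => ?_)
    have : x ∈ Subgroup.closure K := Subgroup.subset_closure (hPK hx)
    rwa [hK, Subgroup.mem_bot] at this
  · right
    obtain ⟨c, hc, hc1⟩ : ∃ c ∈ Subgroup.centralizer (Subgroup.closure K : Set H), c ≠ 1 := by
      by_contra! hall
      refine unbdd (hY.subset fun z hz => ?_).isBounded
      obtain ⟨c, hc, y, hy, rfl⟩ := hC (Or.inl hz)
      simpa [hall c hc] using hy
    have hle : Subgroup.closure K ≤ Subgroup.centralizer {c} := fun z hz =>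
      Subgroup.mem_centralizer_singleton_iff.2 (Subgroup.mem_centralizer_iff.1 hc z hz)
    have hcyc := QuasiQuadratic.isCyclic_centralizer hyp tf hc1
    have hcyc' : IsCyclic (Subgroup.closure K) :=
      isCyclic_of_injective (Subgroup.inclusion hle) (Subgroup.inclusion_injective hle)
    obtain ⟨ξ, hξ⟩ := (Subgroup.isCyclic_iff_exists_zpowers_eq_top _).1 hcyc'
    have hξ1 : ξ ≠ 1 := by
      rintro rfl
      exact hK (by rw [← hξ, Subgroup.zpowers_one_eq_bot])
    refine ⟨Subgroup.centralizer {ξ}, QuasiQuadratic.isCyclic_centralizer hyp tf hξ1, ?_⟩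
    rw [← hξ] at hN
    exact hN.trans (QuasiQuadratic.normalizer_zpowers_le hyp tf hξ1)
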